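/- Call an open set $\Omega\subset\mathbb{R}^2\cong\mathbb{C}$ with non-empty boundary a domain of class $C^k$ (resp. smooth, real analytic) if for each $x_0\in\partial\Omega$ there exist $\varepsilon>0$ and a diffeomorphism $\psi$ of class $C^k$ (resp. smooth, real analytic; a homeomorphism if $k=0$) from the ball $B(x_0,\varepsilon)$ onto a connected open set $D\subset\mathbb{R}^2$ such that $$\psi(B(x_0,\varepsilon)\cap\Omega)=D\cap\{(x,y): y>0\},\qquad \psi(B(x_0,\varepsilon)\cap\partial\Omega)=D\cap\{(x,y): y=0\}.$$ Let $\Omega\subset\mathbb{R}^2$ be a domain of class $C^0$. Assume that there is a function $u:\Omega\to\mathbb{R}$ of class $C^2$ with $\Delta u=0$ and $u>0$ in $\Omega$, such that for every $z_0\in\partial\Omega$ $$\lim_{z\to z_0,\ z\in\Omega}u(z)=0\qquad\text{and}\qquad \lim_{z\to z_0,\ z\in\Omega}|\nabla u(z)|=1.$$ Then $\Omega$ is a smooth domain, and in fact a real analytic domain. Moreover, $u$ extends to a harmonic function on a neighborhood of $\overline\Omega$: there are an open set $V\supset\overline\Omega$ and a harmonic function $v:V\to\mathbb{R}$ with $v=u$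 on $\Omega$. -/

import Mathlib

open scoped Topology ContDiff Gradient

/-- The plane `ℝ²` is identified with `ℂ`, and the upper half-plane is `{im > 0}`.
An open subset `Ω` of the plane with non-empty boundary is a domain of class `C^k`
(`k = 0, 1, 2, …`, `k = ∞` for smooth, `k = ω` for real analytic) if each boundary point `x₀` is
the centre of a ball `B(x₀, ε)` with a diffeomorphism `ψ` of class `C^k` (a homeomorphism if
`k = 0`) from this ball onto a connected open set `D` (here `ψ.target`), which sends
`B(x₀, ε) ∩ Ω` onto `D ∩ {im > 0}` and `B(x₀, ε) ∩ ∂Ω` onto `D ∩ {im = 0}`. -/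
def IsDomainOfClass (k : WithTop ℕ∞) (Ω : Set ℂ) : Prop :=
  IsOpen Ω ∧ (frontier Ω).Nonempty ∧
    ∀ x₀ ∈ frontier Ω, ∃ ε : ℝ, 0 < ε ∧ ∃ ψ : OpenPartialHomeomorph ℂ ℂ,
      ψ.source = Metric.ball x₀ ε ∧ IsConnected ψ.target ∧
      ContDiffOn ℝ k ψ ψ.source ∧ ContDiffOn ℝ k ψ.symm ψ.target ∧
      ψ '' (Metric.ball x₀ ε ∩ Ω) = ψ.target ∩ {w : ℂ | 0 < w.im} ∧
      ψ '' (Metric.ball x₀ ε ∩ frontier Ω) = ψ.target ∩ {w : ℂ | w.im = 0}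

/-- `u` (of which only the values on the open set `Ω` matter) is a classical solution of the
overdetermined problem `Δu = 0` and `u > 0` in `Ω`, `u = 0` and `|∇u| = 1` on `∂Ω`; the boundary
conditions are limits along points of `Ω`. -/
structure IsClassicalSolution (Ω : Set ℂ) (u : ℂ → ℝ) : Prop where
  contDiffOn : ContDiffOn ℝ 2 u Ω
  laplacian_eq_zero : ∀ z ∈ Ω, Laplacian.laplacian u z = 0
  pos : ∀ z ∈ Ω, 0 < u z
  tendsto_zero : ∀ z₀ ∈ frontier Ω, Filter.Tendsto u (𝓝[Ω] z₀) (𝓝 0)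
  tendsto_norm_gradient :
    ∀ z₀ ∈ frontier Ω, Filter.Tendsto (fun z => ‖∇ u z‖) (𝓝[Ω] z₀) (𝓝 1)

/-!
Let `f` be the conjugate of `∇u`. It is holomorphic in `Ω`, it satisfies `1 / 2 ≤ |f| ≤ 2` near a
given boundary point `x₀`, and locally `u` is the real part of a primitive of `f`. The proof studies
the inverse `G` of such a primitive, that is, the solution of `G' = 1 / f(G)`
(`IsInversePotential`).

Start from a point `z₁` of `Ω` close to `x₀`. As long as `G` exists, `u (G w) = re w`, and `u` tends
to zero at the boundary; hence `G w` cannot reach the boundary while `re w > 0`, and `G` continues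
to a half-disc of radius `δ` that does not depend on `z₁` (`IsInversePotential.exists_of_convex`).
At the imaginary axis `re w = u` vanishes, so `G` takes values in the boundary and `|G'| → 1`.
Reflection extends `G` to a full disc with `1 / 2 ≤ |G'| ≤ 2` (`exists_holomorphic_extension`).
Consequently `G` is injective on a disc of a definite size, independent of `z₁`
(`exists_openPartialHomeomorph_of_norm_deriv_mem`), and the image of the axis is an analytic arc in
the boundary which has a definite length and passes arbitrarily close to `x₀`.

Here the hypothesis that `Ω` is a `C⁰` domain enters: the boundary near `x₀` is a topological
interval, so the arc contains all of the boundary near `x₀` (`exists_forall_mem_arc`), and there are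
exterior points near `x₀`, so `Ω` lies on one side of the arc only. Thus `φ = G⁻¹` is a
biholomorphic map near `x₀` with `Ω = {re φ > 0}`, `∂Ω = {re φ = 0}` and `u = re φ` in `Ω`
(`exists_straightening`). The maps `i φ` are the required analytic charts, and the functions `re φ`
extend `u` across the boundary; by the identity theorem they agree on overlaps of small balls
(`exists_harmonic_extension`).
-/

namespace FreeBoundary

open Complex Metric Set Filter
open scoped Interval

/-! ### A quantitative inverse function theorem and local inverse potentials -/

/-- A holomorphic function on a disc of radius `R` whose derivative has modulus between `1 / 2` and
`2` is invertible on a concentric disc whose radius, like that of the disc covered by the image,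
depends only on `R`. This uniformity drives both the continuation of inverse potentials and the
final inversion near a boundary point. -/
theorem exists_openPartialHomeomorph_of_norm_deriv_mem {g : ℂ → ℂ} {z₀ : ℂ} {R : ℝ} (hR : 0 < R)
    (hg : DifferentiableOn ℂ g (ball z₀ R))
    (hlow : ∀ z ∈ ball z₀ R, 1 / 2 ≤ ‖deriv g z‖) (hup : ∀ z ∈ ball z₀ R, ‖deriv g z‖ ≤ 2) :
    ∃ e : OpenPartialHomeomorph ℂ ℂ, (e : ℂ → ℂ) = g ∧ e.source = ball z₀ (R / 32) ∧
      DifferentiableOn ℂ e.symm e.target ∧ ball (g z₀) (R / 256) ⊆ e.target ∧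
      ∀ z ∈ ball z₀ (R / 32), ∀ z' ∈ ball z₀ (R / 32), ‖z - z'‖ ≤ 4 * ‖g z - g z'‖ := by
  have hz₀ : z₀ ∈ ball z₀ R := mem_ball_self hR
  have hsub : ball z₀ (R / 32) ⊆ ball z₀ R := ball_subset_ball (by linarith)
  have hd : ∀ z ∈ ball z₀ R, DifferentiableAt ℂ g z := fun z hz =>
    hg.differentiableAt (isOpen_ball.mem_nhds hz)
  -- The derivative takes values in a ball of radius `5`, so the Schwarz lemma controls its
  -- oscillation.
  have hosc : ∀ z ∈ ball z₀ (R / 32), ‖deriv g z - deriv g z₀‖ ≤ 1 / 4 := by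
    intro z hz
    have hmaps : MapsTo (deriv g) (ball z₀ R) (ball (deriv g z₀) 5) := by
      intro w hw
      rw [mem_ball, dist_eq_norm]
      calc ‖deriv g w - deriv g z₀‖ ≤ ‖deriv g w‖ + ‖deriv g z₀‖ := norm_sub_le _ _
        _ < 5 := by linarith [hup w hw, hup z₀ hz₀]
    have h := Complex.dist_le_div_mul_dist_of_mapsTo_ball (hg.deriv isOpen_ball)
      (hmaps.mono_right ball_subset_closedBall) (hsub hz)
    rw [dist_eq_norm] at h
    rw [mem_ball] at hz
    calc _ ≤ 5 / R * dist z z₀ := h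
      _ ≤ 5 / R * (R / 32) := by gcongr
      _ ≤ 1 / 4 := by field_simp; norm_num
  have happrox : ∀ z ∈ ball z₀ (R / 32), ∀ z' ∈ ball z₀ (R / 32),
      ‖g z - g z' - deriv g z₀ * (z - z')‖ ≤ 1 / 4 * ‖z - z'‖ := by
    intro z hz z' hz'
    have h := (convex_ball z₀ (R / 32)).norm_image_sub_le_of_norm_hasDerivWithin_le
      (f := fun w => g w - deriv g z₀ * w) (f' := fun w => deriv g w - deriv g z₀ * 1)
      (C := 1 / 4) (fun w hw => (((hd w (hsub hw)).hasDerivAt).sub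
        ((hasDerivAt_id w).const_mul _)).hasDerivWithinAt)
      (fun w hw => by simpa using hosc w hw) hz' hz
    rwa [sub_sub_sub_comm, ← mul_sub] at h
  have hne : deriv g z₀ ≠ 0 := norm_pos_iff.1 (by linarith [hlow z₀ hz₀])
  set A : ℂ ≃L[ℂ] ℂ := ContinuousLinearEquiv.unitsEquivAut ℂ (Units.mk0 _ hne) with hA
  have hAapp : ∀ z, A z = deriv g z₀ * z := fun z => by
    simp [hA, ContinuousLinearEquiv.unitsEquivAut_apply, mul_comm]
  have hAL : ApproximatesLinearOn g (A : ℂ →L[ℂ] ℂ) (ball z₀ (R / 32)) (1 / 4 : NNReal) := by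
    intro z hz z' hz'
    simpa [hAapp] using happrox z hz z' hz'
  have hN : (1 / 2 : ℝ) ≤ (‖(A.symm : ℂ →L[ℂ] ℂ)‖₊⁻¹ : NNReal) := by
    have h1 : ‖(A.symm : ℂ →L[ℂ] ℂ)‖ ≤ 2 := by
      refine ContinuousLinearMap.opNorm_le_bound _ (by norm_num) fun z => ?_
      have : z = deriv g z₀ * A.symm z := by rw [← hAapp]; simp
      have h2 : ‖z‖ = ‖deriv g z₀‖ * ‖A.symm z‖ := by rw [← norm_mul, ← this]
      have := mul_le_mul_of_nonneg_right (hlow z₀ hz₀) (norm_nonneg (A.symm z))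
      simp only [ContinuousLinearEquiv.coe_coe]
      linarith
    have h2 : 0 < ‖(A.symm : ℂ →L[ℂ] ℂ)‖ := A.norm_symm_pos
    push_cast
    rw [one_div]
    exact inv_anti₀ h2 h1
  have hc : (1 / 4 : NNReal) < ‖(A.symm : ℂ →L[ℂ] ℂ)‖₊⁻¹ := by
    rw [← NNReal.coe_lt_coe]
    push_cast at hN ⊢
    linarith
  set e := hAL.toOpenPartialHomeomorph g _ (Or.inr hc) isOpen_ball with he
  have hcoe : (e : ℂ → ℂ) = g := rfl
  have hsrc : e.source = ball z₀ (R / 32) := rfl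
  refine ⟨e, hcoe, hsrc, ?_, ?_, ?_⟩
  · intro w hw
    have hmem : e.symm w ∈ ball z₀ R := hsub (hsrc ▸ e.map_target hw)
    have hne' : deriv g (e.symm w) ≠ 0 := norm_pos_iff.1 (by linarith [hlow _ hmem])
    exact (e.hasDerivAt_symm hw hne' (hd _ hmem).hasDerivAt).differentiableAt.differentiableWithinAt
  · refine Subset.trans ?_ (hAL.closedBall_subset_target (Or.inr hc) isOpen_ball (b := z₀)
      (ε := R / 64) (by linarith) (closedBall_subset_ball (by linarith)))
    refine (ball_subset_closedBall).trans (closedBall_subset_closedBall ?_)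
    have : (1 / 4 : ℝ) ≤ ((‖(A.symm : ℂ →L[ℂ] ℂ)‖₊⁻¹ : NNReal) : ℝ) - ((1 / 4 : NNReal) : ℝ) := by
      push_cast at hN ⊢; linarith
    push_cast at this ⊢
    nlinarith
  · intro z hz z' hz'
    have h1 := happrox z hz z' hz'
    have h2 : ‖deriv g z₀‖ * ‖z - z'‖ ≤ ‖g z - g z'‖ + 1 / 4 * ‖z - z'‖ := by
      rw [← norm_mul]
      have := norm_sub_le (g z - g z') (g z - g z' - deriv g z₀ * (z - z'))
      rw [sub_sub_cancel] at this
      linarith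
    have := mul_le_mul_of_nonneg_right (hlow z₀ hz₀) (norm_nonneg (z - z'))
    linarith

/-- `G` solves `G' = 1 / f(G)` on `K` with values in `U`: it is a local inverse, up to an additive
constant, of every primitive of `f`. No global primitive of `f` on `U` is required, so `U` need not
be simply connected. -/
def IsInversePotential (f : ℂ → ℂ) (U K : Set ℂ) (G : ℂ → ℂ) : Prop :=
  ∀ w ∈ K, G w ∈ U ∧ HasDerivAt G (f (G w))⁻¹ w

namespace IsInversePotential

variable {f : ℂ → ℂ} {U K : Set ℂ} {G : ℂ → ℂ}

theorem mono {K' : Set ℂ} (h : IsInversePotential f U K G) (hK : K' ⊆ K) :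
    IsInversePotential f U K' G := fun w hw => h w (hK hw)

theorem differentiableOn (h : IsInversePotential f U K G) : DifferentiableOn ℂ G K :=
  fun w hw => (h w hw).2.differentiableAt.differentiableWithinAt

/-- Local existence, on a disc whose radius depends only on the distance to the complement of
`U`. -/
theorem exists_ball (hf : DifferentiableOn ℂ f U) (hlow : ∀ z ∈ U, 1 / 2 ≤ ‖f z‖)
    (hup : ∀ z ∈ U, ‖f z‖ ≤ 2) {z : ℂ} {s : ℝ} (hs : 0 < s) (hz : ball z s ⊆ U) (w : ℂ) :
    ∃ G, G w = z ∧ IsInversePotential f U (ball w (s / 256)) G := by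
  obtain ⟨F, hFz, hF⟩ := ((hf.mono hz).isExactOn_ball).with_val_at z w
  obtain ⟨e, hcoe, hsrc, -, htgt, -⟩ := exists_openPartialHomeomorph_of_norm_deriv_mem (g := F) hs
    (fun x hx => (hF x hx).differentiableAt.differentiableWithinAt)
    (fun x hx => by rw [(hF x hx).deriv]; exact hlow x (hz hx))
    (fun x hx => by rw [(hF x hx).deriv]; exact hup x (hz hx))
  rw [hFz] at htgt
  have hsub : ball z (s / 32) ⊆ ball z s := ball_subset_ball (by linarith)
  refine ⟨e.symm, ?_, fun x hx => ?_⟩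
  · have := e.left_inv (x := z) (hsrc ▸ mem_ball_self (by positivity))
    rwa [hcoe, hFz] at this
  · have hmem : e.symm x ∈ ball z s := hsub (hsrc ▸ e.map_target (htgt hx))
    refine ⟨hz hmem, e.hasDerivAt_symm (htgt hx) ?_ (hcoe ▸ hF _ hmem)⟩
    exact norm_pos_iff.1 (by linarith [hlow _ (hz hmem)])

/-- Two inverse potentials on a connected set that agree at one point are equal: near that point
both invert the same primitive of `f`. -/
theorem eqOn (hU : IsOpen U) (hf : DifferentiableOn ℂ f U) (hlow : ∀ z ∈ U, 1 / 2 ≤ ‖f z‖)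
    (hK : IsOpen K) (hKc : IsPreconnected K) {G₁ G₂ : ℂ → ℂ}
    (h₁ : IsInversePotential f U K G₁) (h₂ : IsInversePotential f U K G₂) {p : ℂ} (hp : p ∈ K)
    (hpe : G₁ p = G₂ p) : EqOn G₁ G₂ K := by
  refine (h₁.differentiableOn.analyticOnNhd hK).eqOn_of_preconnected_of_eventuallyEq
    (h₂.differentiableOn.analyticOnNhd hK) hKc hp ?_
  obtain ⟨s, hs, hsU⟩ := Metric.isOpen_iff.1 hU (G₁ p) (h₁ p hp).1
  obtain ⟨F, hF⟩ := (hf.mono hsU).isExactOn_ball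
  have hFs : HasStrictDerivAt F (f (G₁ p)) (G₁ p) := by
    have hFd : DifferentiableOn ℂ F (ball (G₁ p) s) :=
      fun x hx => (hF x hx).differentiableAt.differentiableWithinAt
    have := ((hFd.analyticOnNhd isOpen_ball) _ (mem_ball_self hs)).hasStrictDerivAt
    rwa [(hF _ (mem_ball_self hs)).deriv] at this
  have hne : f (G₁ p) ≠ 0 := norm_pos_iff.1 (by linarith [hlow _ (h₁ p hp).1])
  -- `F` is injective near `G₁ p`, and `F ∘ G` has derivative one for both solutions.
  have hinj : ∀ᶠ q in 𝓝 (G₁ p, G₁ p), F q.1 = F q.2 → q.1 = q.2 := by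
    have hleft := hFs.eventually_left_inverse hne
    filter_upwards [hleft.prod_nhds hleft] with q hq h
    rw [← hq.1, h, hq.2]
  have hc₁ : ContinuousAt G₁ p := (h₁ p hp).2.continuousAt
  have hc₂ : ContinuousAt G₂ p := (h₂ p hp).2.continuousAt
  have hev : ∀ᶠ w in 𝓝 p, w ∈ K ∧ G₁ w ∈ ball (G₁ p) s ∧ G₂ w ∈ ball (G₁ p) s := by
    filter_upwards [hK.mem_nhds hp, hc₁ (isOpen_ball.mem_nhds (mem_ball_self hs)),
      hc₂ (isOpen_ball.mem_nhds (by rw [← hpe]; exact mem_ball_self hs))] with w a b c using ⟨a, b, c⟩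
  obtain ⟨r, hr, hball⟩ := Metric.eventually_nhds_iff_ball.1 hev
  have hder : ∀ {G : ℂ → ℂ}, IsInversePotential f U K G → G p = G₁ p →
      (∀ w ∈ ball p r, G w ∈ ball (G₁ p) s) → ∀ w ∈ ball p r, F (G w) = w - p + F (G₁ p) := by
    intro G hG hGp hGm w hw
    have hd : ∀ x ∈ ball p r, HasDerivWithinAt (fun x => F (G x) - x) 0 (ball p r) x := by
      intro x hx
      have hx' := hball x hx
      have h0 : f (G x) ≠ 0 := norm_pos_iff.1 (by linarith [hlow _ (hG x hx'.1).1])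
      have := ((hF _ (hGm x hx)).comp x (hG x hx'.1).2).sub (hasDerivAt_id x)
      rw [mul_inv_cancel₀ h0, sub_self] at this
      exact this.hasDerivWithinAt
    have := (convex_ball p r).norm_image_sub_le_of_norm_hasDerivWithin_le (C := 0) hd
      (by simp) (mem_ball_self hr) hw
    rw [zero_mul, norm_le_zero_iff, sub_eq_zero, hGp] at this
    linear_combination this
  have hpair : Tendsto (fun w => (G₁ w, G₂ w)) (𝓝 p) (𝓝 (G₁ p, G₁ p)) := by
    have := hc₁.tendsto.prodMk_nhds hc₂.tendsto
    rwa [← hpe] at this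
  filter_upwards [hpair.eventually hinj, ball_mem_nhds p hr] with w hw hwr
  refine hw ?_
  rw [hder h₁ rfl (fun x hx => (hball x hx).2.1) w hwr,
    hder h₂ hpe.symm (fun x hx => (hball x hx).2.2) w hwr]

theorem exists_iUnion {ι : Type*} {K : ι → Set ℂ} {G : ι → ℂ → ℂ} (hK : ∀ i, IsOpen (K i))
    (hG : ∀ i, IsInversePotential f U (K i) (G i))
    (hcompat : ∀ i j, EqOn (G i) (G j) (K i ∩ K j)) :
    ∃ H, IsInversePotential f U (⋃ i, K i) H ∧ ∀ i, EqOn H (G i) (K i) := by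
  classical
  let H : ℂ → ℂ := fun w => if h : ∃ i, w ∈ K i then G h.choose w else 0
  have hH : ∀ i, EqOn H (G i) (K i) := by
    intro i w hw
    have h : ∃ i, w ∈ K i := ⟨i, hw⟩
    simp only [H, dif_pos h]
    exact hcompat _ _ ⟨h.choose_spec, hw⟩
  refine ⟨H, fun w hw => ?_, hH⟩
  obtain ⟨i, hi⟩ := mem_iUnion.1 hw
  have hev : H =ᶠ[𝓝 w] G i := (hH i).eventuallyEq_of_mem ((hK i).mem_nhds hi)
  rw [hev.eq_of_nhds]
  exact ⟨(hG i w hi).1, (hG i w hi).2.congr_of_eventuallyEq hev⟩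

/-- If the values of an inverse potential on a convex set keep a definite distance from the
complement of `U`, then it extends to a thickening of that set. -/
theorem exists_thickening (hU : IsOpen U) (hf : DifferentiableOn ℂ f U)
    (hlow : ∀ z ∈ U, 1 / 2 ≤ ‖f z‖) (hup : ∀ z ∈ U, ‖f z‖ ≤ 2)
    (hK : IsOpen K) (hKc : Convex ℝ K) (hG : IsInversePotential f U K G) {s : ℝ} (hs : 0 < s)
    (hball : ∀ w ∈ K, ball (G w) s ⊆ U) :
    ∃ H, IsInversePotential f U (thickening (s / 256) K) H ∧ EqOn H G K := by
  choose! L hLw hL using fun w (hw : w ∈ K) => exists_ball hf hlow hup hs (hball w hw) w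
  have hLG : ∀ w ∈ K, EqOn (L w) G (ball w (s / 256) ∩ K) := fun w hw =>
    eqOn hU hf hlow (isOpen_ball.inter hK) (((convex_ball _ _).inter hKc).isPreconnected)
      ((hL w hw).mono inter_subset_left) (hG.mono inter_subset_right)
      ⟨mem_ball_self (by positivity), hw⟩ (hLw w hw)
  obtain ⟨H, hH, hHL⟩ := exists_iUnion (ι := K) (K := fun w => ball (w : ℂ) (s / 256))
    (G := fun w => L w) (f := f) (U := U) (fun _ => isOpen_ball) (fun w => hL w w.2) (by
      rintro ⟨w, hw⟩ ⟨w', hw'⟩ x hx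
      -- Two overlapping balls with centres in `K` share the midpoint of their centres.
      have hdist : dist w w' < 2 * (s / 256) := by
        have h1 := hx.1
        have h2 := hx.2
        simp only [mem_ball] at h1 h2
        linarith [dist_triangle_left w w' x]
      have hm : midpoint ℝ w w' ∈ K := hKc.midpoint_mem hw hw'
      have hmw : midpoint ℝ w w' ∈ ball w (s / 256) := by
        rw [mem_ball, dist_midpoint_left]; norm_num; linarith
      have hmw' : midpoint ℝ w w' ∈ ball w' (s / 256) := by
        rw [mem_ball, dist_midpoint_right]; norm_num; linarith
      exact eqOn hU hf hlow (isOpen_ball.inter isOpen_ball)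
        (((convex_ball _ _).inter (convex_ball _ _)).isPreconnected)
        ((hL w hw).mono inter_subset_left) ((hL w' hw').mono inter_subset_right) ⟨hmw, hmw'⟩
        ((hLG w hw ⟨hmw, hm⟩).trans (hLG w' hw' ⟨hmw', hm⟩).symm) hx)
  refine ⟨H, ?_, fun w hw => ?_⟩
  · rwa [thickening_eq_biUnion_ball, biUnion_eq_iUnion]
  · rw [hHL ⟨w, hw⟩ (mem_ball_self (by positivity))]
    exact hLw w hw

end IsInversePotential


/-! ### Continuation of inverse potentials to convex sets -/

/-- The image of `K` under the homothety with centre `w₀` and ratio `t ≠ 0`, written as a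
preimage. -/
def shrink (w₀ : ℂ) (t : ℝ) (K : Set ℂ) : Set ℂ := AffineMap.homothety w₀ t⁻¹ ⁻¹' K

theorem mem_shrink {w₀ w : ℂ} {t : ℝ} {K : Set ℂ} :
    w ∈ shrink w₀ t K ↔ t⁻¹ • (w - w₀) + w₀ ∈ K := by
  simp [shrink, AffineMap.homothety_apply]

section shrink

variable {w₀ : ℂ} {t t' : ℝ} {K : Set ℂ}

theorem isOpen_shrink (hK : IsOpen K) : IsOpen (shrink w₀ t K) :=
  hK.preimage (AffineMap.homothety_continuous _ _)

theorem convex_shrink (hK : Convex ℝ K) : Convex ℝ (shrink w₀ t K) :=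
  hK.affine_preimage _

theorem center_mem_shrink (h : w₀ ∈ K) : w₀ ∈ shrink w₀ t K := by
  simpa [mem_shrink] using h

theorem shrink_mono (hK : Convex ℝ K) (h : w₀ ∈ K) (ht : 0 < t) (htt' : t ≤ t') :
    shrink w₀ t K ⊆ shrink w₀ t' K := by
  intro w hw
  rw [mem_shrink] at hw ⊢
  have ht' : 0 < t' := ht.trans_le htt'
  have := hK hw h (a := t / t') (b := 1 - t / t') (by positivity)
    (sub_nonneg.2 ((div_le_one ht').2 htt')) (by ring)
  convert this using 1
  rw [smul_add, smul_smul, sub_smul, one_smul, div_mul_eq_mul_div, mul_inv_cancel₀ ht.ne', one_div]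
  abel

theorem shrink_subset (hK : Convex ℝ K) (h : w₀ ∈ K) (ht : 0 < t) (ht1 : t ≤ 1) :
    shrink w₀ t K ⊆ K := by
  refine (shrink_mono hK h ht ht1).trans fun w hw => ?_
  simpa [mem_shrink] using hw

theorem exists_mem_shrink (hK : IsOpen K) {w : ℂ} (hw : w ∈ K) :
    ∃ t : ℝ, 0 < t ∧ t < 1 ∧ w ∈ shrink w₀ t K := by
  have hc : ContinuousAt (fun t : ℝ => t⁻¹ • (w - w₀) + w₀) 1 := by
    have : ContinuousAt (fun t : ℝ => t⁻¹) 1 := continuousAt_inv₀ one_ne_zero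
    fun_prop
  have hev : ∀ᶠ t in 𝓝[<] (1 : ℝ), t⁻¹ • (w - w₀) + w₀ ∈ K :=
    (hc.tendsto.mono_left nhdsWithin_le_nhds).eventually (hK.mem_nhds (by simpa using hw))
  obtain ⟨t, ht, h0, h1⟩ := (hev.and (Ioo_mem_nhdsLT (show (0 : ℝ) < 1 by norm_num))).exists
  exact ⟨t, h0, h1, mem_shrink.2 ht⟩

theorem shrink_subset_ball {M : ℝ} (ht : 0 < t) (hM : K ⊆ ball w₀ M) :
    shrink w₀ t K ⊆ ball w₀ (t * M) := by
  intro w hw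
  have := hM (mem_shrink.1 hw)
  rw [mem_ball, dist_eq_norm, add_sub_cancel_right, norm_smul, norm_inv, Real.norm_of_nonneg ht.le,
    inv_mul_lt_iff₀ ht] at this
  rwa [mem_ball, dist_eq_norm]

/-- Enlarging a homothetic copy of a bounded set by a small ratio stays in a small thickening. -/
theorem shrink_subset_thickening {M r : ℝ} (ht : 0 < t) (htt' : t ≤ t') (ht' : t' ≤ 1)
    (hM : K ⊆ ball w₀ M) (hr : 0 < r) (hrM : (1 - t / t') * M ≤ r) :
    shrink w₀ t' K ⊆ thickening r (shrink w₀ t K) := by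
  intro w hw
  have ht'0 : 0 < t' := ht.trans_le htt'
  have hwM := shrink_subset_ball ht'0 hM hw
  rw [mem_ball, dist_eq_norm] at hwM
  rw [mem_thickening_iff]
  refine ⟨(t / t') • (w - w₀) + w₀, ?_, ?_⟩
  · rw [mem_shrink] at hw ⊢
    rwa [add_sub_cancel_right, smul_smul, div_eq_mul_inv, ← mul_assoc, inv_mul_cancel₀ ht.ne',
      one_mul]
  · have h1 : w - ((t / t') • (w - w₀) + w₀) = (1 - t / t') • (w - w₀) := by
      rw [sub_smul, one_smul]; abel
    have h2 : 0 ≤ 1 - t / t' := sub_nonneg.2 ((div_le_one ht'0).2 htt')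
    have hMpos : 0 ≤ M := by nlinarith [norm_nonneg (w - w₀)]
    rw [dist_eq_norm, h1, norm_smul, Real.norm_of_nonneg h2]
    rcases h2.eq_or_lt with h0 | h0
    · rwa [← h0, zero_mul]
    · refine lt_of_lt_of_le (mul_lt_mul_of_pos_left ?_ h0) hrM
      exact hwM.trans_le (mul_le_of_le_one_left hMpos ht')

end shrink

namespace IsInversePotential

variable {f : ℂ → ℂ} {U K : Set ℂ} {G : ℂ → ℂ}

/-- Monodromy for inverse potentials on a bounded convex set `K`: the solution with `G w₀ = z₀`
exists on all of `K` as soon as solutions on the homothetic copies of `K` of ratio bounded away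
from `1` keep a definite distance from the complement of `U`. -/
theorem exists_of_convex (hU : IsOpen U) (hf : DifferentiableOn ℂ f U)
    (hlow : ∀ z ∈ U, 1 / 2 ≤ ‖f z‖) (hup : ∀ z ∈ U, ‖f z‖ ≤ 2)
    (hK : IsOpen K) (hKc : Convex ℝ K) {w₀ z₀ : ℂ} (hw₀ : w₀ ∈ K) (hz₀ : z₀ ∈ U)
    {M : ℝ} (hM : K ⊆ ball w₀ M)
    (hstay : ∀ τ ∈ Ioo (0 : ℝ) 1, ∃ s > 0, ∀ t ∈ Ioc 0 τ, ∀ G,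
      IsInversePotential f U (shrink w₀ t K) G → G w₀ = z₀ →
        ∀ w ∈ shrink w₀ t K, ball (G w) s ⊆ U) :
    ∃ G, IsInversePotential f U K G ∧ G w₀ = z₀ := by
  have hMpos : 0 < M := by simpa using (hM hw₀)
  have hex : ∀ τ ∈ Ioo (0 : ℝ) 1,
      ∃ G, IsInversePotential f U (shrink w₀ τ K) G ∧ G w₀ = z₀ := by
    intro τ hτ
    obtain ⟨s, hs, hstay⟩ := hstay τ hτ
    obtain ⟨s₀, hs₀, hs₀U⟩ := Metric.isOpen_iff.1 hU z₀ hz₀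
    obtain ⟨G₀, hG₀z, hG₀⟩ := exists_ball hf hlow hup hs₀ hs₀U w₀
    -- A homothetic copy may be enlarged by the factor `1 / θ` within one thickening of radius
    -- `s / 256`.
    set θ : ℝ := max (1 / 2) (1 - s / 512 / M) with hθ
    have hθ0 : 0 < θ := lt_max_of_lt_left (by norm_num)
    have hθ1 : θ < 1 := max_lt (by norm_num) (by have : 0 < s / 512 / M := by positivity
                                                 linarith)
    have hθM : (1 - θ) * M < s / 256 := by
      have h1 : 1 - θ ≤ s / 512 / M := by linarith [le_max_right (1 / 2) (1 - s / 512 / M)]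
      calc (1 - θ) * M ≤ s / 512 / M * M := by gcongr
        _ = s / 512 := by field_simp
        _ < s / 256 := by linarith
    -- Each step multiplies the ratio of the homothety by at most `1 / θ`.
    have key : ∀ n : ℕ, ∀ t ∈ Ioc 0 τ, θ ^ n * t * M ≤ s₀ / 256 →
        ∃ G, IsInversePotential f U (shrink w₀ t K) G ∧ G w₀ = z₀ := by
      intro n
      induction n with
      | zero =>
        intro t ht htM
        rw [pow_zero, one_mul] at htM
        exact ⟨G₀, hG₀.mono ((shrink_subset_ball ht.1 hM).trans (ball_subset_ball htM)), hG₀z⟩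
      | succ n ih =>
        intro t ht htM
        have hθt : θ * t ≤ t := mul_le_of_le_one_left ht.1.le hθ1.le
        have hθt0 : 0 < θ * t := mul_pos hθ0 ht.1
        obtain ⟨G, hG, hGz⟩ := ih (θ * t) ⟨hθt0, hθt.trans ht.2⟩ (by
          rwa [← mul_assoc, ← pow_succ])
        obtain ⟨H, hH, hHG⟩ := exists_thickening hU hf hlow hup (isOpen_shrink hK)
          (convex_shrink hKc) hG hs (hstay _ ⟨hθt0, hθt.trans ht.2⟩ G hG hGz)
        refine ⟨H, hH.mono ?_, (hHG (center_mem_shrink hw₀)).trans hGz⟩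
        refine shrink_subset_thickening hθt0 hθt (ht.2.trans hτ.2.le) hM (by positivity) ?_
        rw [mul_div_assoc, div_self ht.1.ne', mul_one]
        exact hθM.le
    obtain ⟨n, hn⟩ := exists_pow_lt_of_lt_one (show 0 < s₀ / 256 / M by positivity) hθ1
    refine key n τ ⟨hτ.1, le_rfl⟩ ?_
    have h1 : θ ^ n * τ ≤ θ ^ n := mul_le_of_le_one_right (by positivity) hτ.2.le
    calc θ ^ n * τ * M ≤ s₀ / 256 / M * M := by gcongr; exact h1.trans hn.le
      _ = s₀ / 256 := by field_simp
  choose G hG hGz using fun τ : Ioo (0 : ℝ) 1 => hex τ τ.2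
  obtain ⟨H, hH, hHG⟩ := exists_iUnion (ι := Ioo (0 : ℝ) 1) (K := fun τ => shrink w₀ τ K) (G := G)
    (f := f) (U := U) (fun _ => isOpen_shrink hK) hG (fun τ τ' =>
      eqOn hU hf hlow ((isOpen_shrink hK).inter (isOpen_shrink hK))
        ((convex_shrink hKc).inter (convex_shrink hKc)).isPreconnected
        ((hG τ).mono inter_subset_left) ((hG τ').mono inter_subset_right)
        ⟨center_mem_shrink hw₀, center_mem_shrink hw₀⟩ ((hGz τ).trans (hGz τ').symm))
  refine ⟨H, hH.mono fun w hw => ?_, ?_⟩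
  · obtain ⟨t, h0, h1, hwt⟩ := exists_mem_shrink (w₀ := w₀) hK hw
    exact mem_iUnion.2 ⟨⟨t, h0, h1⟩, hwt⟩
  · have := hHG ⟨1 / 2, by norm_num⟩ (center_mem_shrink hw₀)
    rw [this, hGz]

/-- Inverse potentials are Lipschitz on convex sets. -/
theorem norm_sub_le (hlow : ∀ z ∈ U, 1 / 2 ≤ ‖f z‖) (hKc : Convex ℝ K)
    (hG : IsInversePotential f U K G) {w w' : ℂ} (hw : w ∈ K) (hw' : w' ∈ K) :
    ‖G w - G w'‖ ≤ 2 * ‖w - w'‖ := by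
  refine hKc.norm_image_sub_le_of_norm_hasDerivWithin_le
    (fun x hx => (hG x hx).2.hasDerivWithinAt) (fun x hx => ?_) hw' hw
  rw [norm_inv]
  exact inv_le_of_inv_le₀ (by norm_num) (by linarith [hlow _ (hG x hx).1])

/-- If `f` is the conjugate of `∇u`, so that `u` is locally the real part of a primitive of `f`,
then `u ∘ G` is the real part. -/
theorem apply_eq_re {u : ℂ → ℝ} (hlow : ∀ z ∈ U, 1 / 2 ≤ ‖f z‖)
    (hu : ∀ z ∈ U, HasGradientAt u (starRingEnd ℂ (f z)) z)
    (hKc : Convex ℝ K) (hG : IsInversePotential f U K G) {w₀ : ℂ} (hw₀ : w₀ ∈ K)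
    (h₀ : u (G w₀) = w₀.re) {w : ℂ} (hw : w ∈ K) : u (G w) = w.re := by
  have hd : ∀ x ∈ K, HasFDerivWithinAt (fun x => u (G x) - x.re) (0 : ℂ →L[ℝ] ℝ) K x := by
    intro x hx
    have hne : f (G x) ≠ 0 := norm_pos_iff.1 (by linarith [hlow _ (hG x hx).1])
    have h1 := (hu _ (hG x hx).1).hasFDerivAt.comp x
      ((hG x hx).2.hasFDerivAt.restrictScalars ℝ)
    have h2 := h1.sub (reCLM.hasFDerivAt (x := x))
    refine (h2.congr_fderiv ?_).hasFDerivWithinAt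
    ext v
    simp [Complex.inner, hne]
  have := hKc.norm_image_sub_le_of_norm_hasFDerivWithin_le (C := 0) hd (by simp) hw₀ hw
  rw [zero_mul, norm_le_zero_iff, h₀, sub_self, sub_zero, sub_eq_zero] at this
  exact this

end IsInversePotential

/-- The gradient of a harmonic function is the conjugate of a holomorphic function. -/
theorem differentiableOn_conj_gradient {u : ℂ → ℝ} {Ω : Set ℂ}
    (hu : InnerProductSpace.HarmonicOnNhd u Ω) :
    DifferentiableOn ℂ (fun z => starRingEnd ℂ (∇ u z)) Ω := by
  intro z hz
  have h : (fun z => starRingEnd ℂ (∇ u z)) =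
      fun z => (fderiv ℝ u z 1 : ℂ) - I * fderiv ℝ u z I := by
    funext z
    have h1 : ∀ v, fderiv ℝ u z v = inner ℝ (∇ u z) v := fun v => by
      rw [← InnerProductSpace.toDual_apply_apply (𝕜 := ℝ), toDual_gradient]
    rw [h1, h1]
    generalize ∇ u z = g
    apply Complex.ext <;> simp [Complex.inner]
  rw [h]
  exact (HarmonicAt.differentiableAt_complex_partial (hu z hz)).differentiableWithinAt


/-! ### Reflection across the imaginary axis -/

/-- The imaginary axis is removable for continuous functions, by Morera's theorem. -/
theorem differentiableOn_of_continuousOn_of_re_ne_zero {f : ℂ → ℂ} {U : Set ℂ} (hU : IsOpen U)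
    (hc : ContinuousOn f U) (hd : ∀ z ∈ U, z.re ≠ 0 → DifferentiableAt ℂ f z) :
    DifferentiableOn ℂ f U := by
  refine (isConservativeOn_and_continuousOn_iff_isDifferentiableOn hU).1 ⟨?_, hc⟩
  intro z w hzw
  rw [← add_eq_zero_iff_eq_neg, wedgeIntegral_add_wedgeIntegral_eq]
  have hc' : ContinuousOn f ([[z.re, w.re]] ×ℂ [[z.im, w.im]]) := hc.mono hzw
  by_cases h0 : (0 : ℝ) ∈ [[z.re, w.re]]
  · -- The rectangle is cut along the line; the integrals over the common side cancel.
    have hsub₁ : [[z.re, 0]] ⊆ [[z.re, w.re]] := uIcc_subset_uIcc left_mem_uIcc h0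
    have hsub₂ : [[0, w.re]] ⊆ [[z.re, w.re]] := uIcc_subset_uIcc h0 right_mem_uIcc
    have hmem : ∀ {a b : ℝ}, [[a, b]] ⊆ [[z.re, w.re]] → ∀ x ∈ Ioo (min a b) (max a b) ×ℂ
        Ioo (min z.im w.im) (max z.im w.im), x ∈ U := fun hab x hx =>
      hzw ⟨hab (Ioo_subset_Icc_self hx.1), Ioo_subset_Icc_self hx.2⟩
    have h₁ := integral_boundary_rect_eq_zero_of_continuousOn_of_differentiableOn f
      z (⟨0, w.im⟩ : ℂ) (hc'.mono fun x hx => ⟨hsub₁ hx.1, hx.2⟩) (fun x hx =>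
        (hd x (hmem hsub₁ x hx) (by
          have := hx.1
          simp only [mem_preimage, mem_Ioo] at this
          intro h
          rcases le_total z.re 0 with h' | h' <;> simp [h, h'] at this)).differentiableWithinAt)
    have h₂ := integral_boundary_rect_eq_zero_of_continuousOn_of_differentiableOn f
      (⟨0, z.im⟩ : ℂ) w (hc'.mono fun x hx => ⟨hsub₂ hx.1, hx.2⟩) (fun x hx =>
        (hd x (hmem hsub₂ x hx) (by
          have := hx.1
          simp only [mem_preimage, mem_Ioo] at this
          intro h
          rcases le_total w.re 0 with h' | h' <;> simp [h, h'] at this)).differentiableWithinAt)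
    have hint : ∀ {t a b : ℝ}, t ∈ [[z.im, w.im]] → [[a, b]] ⊆ [[z.re, w.re]] →
        IntervalIntegrable (fun x : ℝ => f (x + t * I)) MeasureTheory.volume a b := by
      intro t a b ht hab
      refine (hc'.comp (by fun_prop) fun x hx => ?_).intervalIntegrable
      simpa [mem_reProdIm] using And.intro (hab hx) ht
    rw [← intervalIntegral.integral_add_adjacent_intervals (hint left_mem_uIcc hsub₁)
        (hint left_mem_uIcc hsub₂),
      ← intervalIntegral.integral_add_adjacent_intervals (hint right_mem_uIcc hsub₁)
        (hint right_mem_uIcc hsub₂)]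
    simp only [ofReal_zero] at h₁ h₂
    linear_combination h₁ + h₂
  · refine integral_boundary_rect_eq_zero_of_continuousOn_of_differentiableOn f z w hc'
      fun x hx => (hd x (hzw ⟨Ioo_subset_Icc_self hx.1, Ioo_subset_Icc_self hx.2⟩) ?_
        ).differentiableWithinAt
    rintro h
    exact h0 (h ▸ Ioo_subset_Icc_self hx.1)

/-- A function with bounded derivative on a convex set extends continuously to the plane. -/
theorem exists_continuous_extension {G g : ℂ → ℂ} {K : Set ℂ} (hK : Convex ℝ K)
    (hG : ∀ w ∈ K, HasDerivAt G (g w) w) (hg : ∀ w ∈ K, ‖g w‖ ≤ 2) :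
    ∃ G' : ℂ → ℂ, Continuous G' ∧ EqOn G' G K := by
  have hL : LipschitzOnWith 2 G K := LipschitzOnWith.of_dist_le_mul fun w hw w' hw' => by
    simpa [dist_eq_norm] using hK.norm_image_sub_le_of_norm_hasDerivWithin_le
      (fun x hx => (hG x hx).hasDerivWithinAt) hg hw' hw
  obtain ⟨G', hG', heq⟩ := hL.extend_finite_dimension
  exact ⟨G', hG'.continuous, heq.symm⟩

/-- The right half of the disc of radius `δ` centred at the origin. -/
def halfDisc (δ : ℝ) : Set ℂ := ball 0 δ ∩ {w | 0 < w.re}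

theorem isOpen_halfDisc {δ : ℝ} : IsOpen (halfDisc δ) :=
  isOpen_ball.inter (isOpen_lt continuous_const continuous_re)

theorem convex_halfDisc {δ : ℝ} : Convex ℝ (halfDisc δ) :=
  (convex_ball _ _).inter (convex_halfSpace_re_gt 0)

theorem tendsto_add_ofReal_halfDisc {δ : ℝ} {p : ℂ} (hp : p ∈ ball (0 : ℂ) δ) (hp0 : 0 ≤ p.re) :
    Tendsto (fun x : ℝ => p + x) (𝓝[>] 0) (𝓝[halfDisc δ] p) := by
  have hc : Tendsto (fun x : ℝ => p + x) (𝓝[>] 0) (𝓝 p) := by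
    have : Continuous fun x : ℝ => p + x := by fun_prop
    simpa using (this.tendsto 0).mono_left nhdsWithin_le_nhds
  refine tendsto_nhdsWithin_iff.2 ⟨hc, ?_⟩
  filter_upwards [hc (isOpen_ball.mem_nhds hp), self_mem_nhdsWithin] with x hx hx0
  exact ⟨hx, by simp only [mem_ofPred_eq, add_re, ofReal_re]; linarith [mem_Ioi.1 hx0]⟩

theorem norm_inv_sub_conj {a : ℂ} (ha : a ≠ 0) :
    ‖a⁻¹ - starRingEnd ℂ a‖ = |‖a‖⁻¹ - ‖a‖| := by
  have h : a⁻¹ - starRingEnd ℂ a = a⁻¹ * ((1 - ‖a‖ ^ 2 : ℝ) : ℂ) := by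
    push_cast
    rw [← mul_conj']
    field_simp
  have h0 : ‖a‖ ≠ 0 := norm_ne_zero_iff.2 ha
  rw [h, norm_mul, norm_real, norm_inv, Real.norm_eq_abs, ← abs_of_pos (inv_pos.2 (norm_pos_iff.2 ha)),
    ← abs_mul, abs_of_pos (inv_pos.2 (norm_pos_iff.2 ha))]
  congr 1
  field_simp

/-- If `|G'| → 1` at the axis, then `B + conj G`, where `B' = 1 / G'`, is constant on the axis: its
derivative along vertical lines is `i (1 / G' - conj G')`, which tends to zero. -/
theorem add_conj_eq_of_tendsto_norm {G B g : ℂ → ℂ} {δ : ℝ}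
    (hGc : Continuous G) (hBc : Continuous B)
    (hG : ∀ w ∈ halfDisc δ, HasDerivAt G (g w) w)
    (hB : ∀ w ∈ halfDisc δ, HasDerivAt B (g w)⁻¹ w) (hne : ∀ w ∈ halfDisc δ, g w ≠ 0)
    (hlim : ∀ p ∈ ball (0 : ℂ) δ, p.re = 0 → Tendsto (fun w => ‖g w‖) (𝓝[halfDisc δ] p) (𝓝 1))
    {p : ℂ} (hp : p ∈ ball (0 : ℂ) δ) (hp0 : p.re = 0) :
    B p + starRingEnd ℂ (G p) = B 0 + starRingEnd ℂ (G 0) := by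
  set D : ℂ → ℂ := fun w => B w + starRingEnd ℂ (G w) with hD
  have hDc : Continuous D := by fun_prop
  have hmem : ∀ y : ℝ, y ∈ Ioo (-δ) δ ↔ (y * I : ℂ) ∈ ball (0 : ℂ) δ := fun y => by
    simp [abs_lt]
  have key : ∀ y ∈ Ioo (-δ) δ, HasDerivAt (fun y : ℝ => D (y * I)) 0 y := by
    intro y hy
    rw [hasDerivAt_iff_isLittleO, Asymptotics.isLittleO_iff]
    intro ε hε
    have hlim' : Tendsto (fun w => |‖g w‖⁻¹ - ‖g w‖|) (𝓝[halfDisc δ] (y * I)) (𝓝 0) := by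
      have h := hlim _ ((hmem y).1 hy) (by simp)
      simpa using ((h.inv₀ one_ne_zero).sub h).abs
    have hev := hlim'.eventually (ge_mem_nhds hε)
    rw [eventually_nhdsWithin_iff] at hev
    obtain ⟨ρ, hρ, hball⟩ := Metric.eventually_nhds_iff_ball.1
      (hev.and (isOpen_ball.mem_nhds ((hmem y).1 hy)))
    -- On vertical segments near `y * I`, the derivative of `D` is small.
    have hseg : ∀ x ∈ Ioo 0 (ρ / 2), ∀ y' ∈ ball y (ρ / 2),
        ‖D (y' * I + x) - D (y * I + x)‖ ≤ ε * ‖y' - y‖ := by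
      intro x hx y' hy'
      have hin : ∀ t ∈ ball y (ρ / 2), (t * I + x : ℂ) ∈ ball (y * I : ℂ) ρ := by
        intro t ht
        rw [mem_ball, dist_eq_norm] at ht ⊢
        calc ‖(t * I + x - y * I : ℂ)‖ = ‖((t - y : ℝ) : ℂ) * I + (x : ℂ)‖ := by
              congr 1; push_cast; ring
          _ ≤ ‖((t - y : ℝ) : ℂ) * I‖ + ‖(x : ℂ)‖ := norm_add_le _ _
          _ = ‖t - y‖ + |x| := by
              rw [norm_mul, norm_I, mul_one, norm_real, norm_real, Real.norm_eq_abs x]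
          _ < ρ := by rw [abs_of_pos hx.1]; linarith [hx.2]
      have hin' : ∀ t ∈ ball y (ρ / 2), (t * I + x : ℂ) ∈ halfDisc δ := fun t ht =>
        ⟨(hball _ (hin t ht)).2, by simpa using hx.1⟩
      refine (convex_ball y (ρ / 2)).norm_image_sub_le_of_norm_hasDerivWithin_le
        (f := fun t : ℝ => D (t * I + x))
        (f' := fun t : ℝ => (g (t * I + x))⁻¹ * I + starRingEnd ℂ (g (t * I + x) * I))
        (fun t ht => ?_) (fun t ht => ?_) (mem_ball_self (by positivity)) hy'
      · have hl : HasDerivAt (fun t : ℝ => (t * I + x : ℂ)) I t := by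
          simpa using ((hasDerivAt_id t).ofReal_comp.mul_const I).add_const (x : ℂ)
        have h1 := HasDerivAt.comp t (hB _ (hin' t ht)) hl
        have h2 := HasDerivAt.comp t (hG _ (hin' t ht)) hl
        have h3 := conjCLE.hasFDerivAt.comp_hasDerivAt t h2
        exact (h1.add h3).hasDerivWithinAt
      · have hm := (hball _ (hin t ht)).1 (hin' t ht)
        rw [← norm_inv_sub_conj (hne _ (hin' t ht))] at hm
        rw [map_mul, conj_I, mul_neg, ← sub_eq_add_neg, ← sub_mul, norm_mul, norm_I, mul_one]
        exact hm
    filter_upwards [ball_mem_nhds y (half_pos hρ)] with y' hy'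
    have hl : ∀ t : ℝ, Tendsto (fun x : ℝ => D (t * I + x)) (𝓝[>] 0) (𝓝 (D (t * I))) := by
      intro t
      have : Continuous fun x : ℝ => D (t * I + x) := by fun_prop
      simpa using (this.tendsto 0).mono_left nhdsWithin_le_nhds
    simp only [smul_zero, sub_zero]
    refine le_of_tendsto ((hl y').sub (hl y)).norm ?_
    filter_upwards [Ioo_mem_nhdsGT (half_pos hρ)] with x hx using hseg x hx y' hy'
  have hδ : 0 < δ := pos_of_mem_ball hp
  have hpI : p = (p.im : ℂ) * I := by apply Complex.ext <;> simp [hp0]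
  have h := (convex_Ioo (-δ) δ).norm_image_sub_le_of_norm_hasDerivWithin_le (C := 0)
    (fun y hy => (key y hy).hasDerivWithinAt) (by simp) (x := 0) (y := p.im) ⟨by linarith, hδ⟩
    ((hmem _).2 (hpI ▸ hp))
  rw [zero_mul, norm_le_zero_iff, sub_eq_zero, ← hpI] at h
  simpa using h

/-- A reflection principle: a holomorphic `G` on the right half-disc with `|G'| → 1` at the axis
extends to the whole disc, and the bounds on `|G'|` persist. With `B' = 1 / G'`, the extension is
`w ↦ c - conj (B (-conj w))` on the left. Working with the primitives `G` and `B`, which are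
Lipschitz, gives continuity up to the axis without any boundary regularity of `G'` itself. -/
theorem exists_holomorphic_extension {G g : ℂ → ℂ} {δ : ℝ}
    (hG : ∀ w ∈ halfDisc δ, HasDerivAt G (g w) w)
    (hlow : ∀ w ∈ halfDisc δ, 1 / 2 ≤ ‖g w‖) (hup : ∀ w ∈ halfDisc δ, ‖g w‖ ≤ 2)
    (hlim : ∀ p ∈ ball (0 : ℂ) δ, p.re = 0 → Tendsto (fun w => ‖g w‖) (𝓝[halfDisc δ] p) (𝓝 1)) :
    ∃ H : ℂ → ℂ, DifferentiableOn ℂ H (ball 0 δ) ∧ EqOn H G (halfDisc δ) ∧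
      (∀ w ∈ ball (0 : ℂ) δ, 1 / 2 ≤ ‖deriv H w‖) ∧ ∀ w ∈ ball (0 : ℂ) δ, ‖deriv H w‖ ≤ 2 := by
  have hne : ∀ w ∈ halfDisc δ, g w ≠ 0 := fun w hw => norm_pos_iff.1 (by linarith [hlow w hw])
  have hgd : DifferentiableOn ℂ g (halfDisc δ) := by
    have hGd : DifferentiableOn ℂ G (halfDisc δ) := fun w hw =>
      (hG w hw).differentiableAt.differentiableWithinAt
    exact (hGd.deriv isOpen_halfDisc).congr fun w hw => (hG w hw).deriv.symm
  have hinv : ∀ w ∈ halfDisc δ, ‖(g w)⁻¹‖ ≤ 2 ∧ 1 / 2 ≤ ‖(g w)⁻¹‖ := by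
    intro w hw
    have h1 := hlow w hw
    have h2 := hup w hw
    rw [norm_inv]
    constructor
    · exact inv_le_of_inv_le₀ (by norm_num) (by linarith)
    · rw [one_div]; exact inv_anti₀ (by linarith) h2
  obtain ⟨B, hB⟩ := convex_halfDisc.exists_forall_hasDerivWithinAt (hgd.inv hne)
  replace hB : ∀ w ∈ halfDisc δ, HasDerivAt B (g w)⁻¹ w := fun w hw =>
    (hB w hw).hasDerivAt (isOpen_halfDisc.mem_nhds hw)
  obtain ⟨G', hG'c, hG'⟩ := exists_continuous_extension convex_halfDisc hG hup
  obtain ⟨B', hB'c, hB'⟩ := exists_continuous_extension convex_halfDisc hB fun w hw => (hinv w hw).1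
  have hG'd : ∀ w ∈ halfDisc δ, HasDerivAt G' (g w) w := fun w hw =>
    (hG w hw).congr_of_eventuallyEq (hG'.eventuallyEq_of_mem (isOpen_halfDisc.mem_nhds hw))
  have hB'd : ∀ w ∈ halfDisc δ, HasDerivAt B' (g w)⁻¹ w := fun w hw =>
    (hB w hw).congr_of_eventuallyEq (hB'.eventuallyEq_of_mem (isOpen_halfDisc.mem_nhds hw))
  have haxis := fun {p : ℂ} (hp : p ∈ ball (0 : ℂ) δ) (hp0 : p.re = 0) =>
    add_conj_eq_of_tendsto_norm hG'c hB'c hG'd hB'd hne hlim hp hp0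
  set c := starRingEnd ℂ (B' 0 + starRingEnd ℂ (G' 0)) with hc
  let L : ℂ → ℂ := fun w => c - starRingEnd ℂ (B' (starRingEnd ℂ (-w)))
  let H : ℂ → ℂ := fun w => if 0 ≤ w.re then G' w else L w
  have hHc : ContinuousOn H (ball 0 δ) := by
    refine ContinuousOn.if ?_ hG'c.continuousOn ?_
    · rintro w ⟨hw, hw0⟩
      have hw0 : w.re = 0 := by
        have := frontier_le_subset_eq continuous_const continuous_re hw0
        exact this.symm
      have hww : starRingEnd ℂ (-w) = w := by apply Complex.ext <;> simp [hw0]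
      have := congrArg (starRingEnd ℂ) (haxis hw hw0)
      simp only [L, hww]
      rw [hc, ← this]
      simp
    · have : Continuous L := by fun_prop
      exact this.continuousOn
  have hright : ∀ w ∈ halfDisc δ, HasDerivAt H (g w) w := by
    intro w hw
    refine (hG'd w hw).congr_of_eventuallyEq ?_
    filter_upwards [isOpen_halfDisc.mem_nhds hw] with x hx
    exact if_pos (le_of_lt hx.2)
  have hleft : ∀ w ∈ ball (0 : ℂ) δ, w.re < 0 → starRingEnd ℂ (-w) ∈ halfDisc δ ∧
      HasDerivAt H (starRingEnd ℂ (g (starRingEnd ℂ (-w)))⁻¹) w := by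
    intro w hw hw0
    have hmem : starRingEnd ℂ (-w) ∈ halfDisc δ := by
      refine ⟨?_, by simpa using hw0⟩
      rw [mem_ball_zero_iff] at hw ⊢
      rwa [RCLike.norm_conj, norm_neg]
    refine ⟨hmem, ?_⟩
    have h1 := (hB'd _ hmem).conj_conj
    rw [conj_conj] at h1
    have h2 := ((h1.comp w (hasDerivAt_neg w)).const_sub c)
    have h3 : HasDerivAt L (starRingEnd ℂ (g (starRingEnd ℂ (-w)))⁻¹) w := by
      rw [mul_neg_one, neg_neg] at h2
      exact h2
    refine h3.congr_of_eventuallyEq ?_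
    filter_upwards [(isOpen_lt continuous_re continuous_const).mem_nhds hw0] with x hx
    exact if_neg (not_le.2 hx)
  have hHd : DifferentiableOn ℂ H (ball 0 δ) := by
    refine differentiableOn_of_continuousOn_of_re_ne_zero isOpen_ball hHc fun w hw hw0 => ?_
    rcases hw0.lt_or_gt with h | h
    · exact (hleft w hw h).2.differentiableAt
    · exact (hright w ⟨hw, h⟩).differentiableAt
  have hbound : ∀ w ∈ ball (0 : ℂ) δ, ‖deriv H w‖ ∈ Icc (1 / 2 : ℝ) 2 := by
    intro w hw
    rcases lt_or_ge w.re 0 with h | h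
    · obtain ⟨h1, h2⟩ := hleft w hw h
      rw [h2.deriv, RCLike.norm_conj]
      exact ⟨(hinv _ h1).2, (hinv _ h1).1⟩
    · have hcont : ContinuousAt (deriv H) w :=
        ((hHd.deriv isOpen_ball).differentiableAt (isOpen_ball.mem_nhds hw)).continuousAt
      have hT := (hcont.tendsto.mono_left nhdsWithin_le_nhds).comp (tendsto_add_ofReal_halfDisc hw h)
      refine isClosed_Icc.mem_of_tendsto hT.norm ?_
      filter_upwards [(tendsto_nhdsWithin_iff.1 (tendsto_add_ofReal_halfDisc hw h)).2] with x hx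
      simp only [Function.comp_apply]
      rw [(hright _ hx).deriv]
      exact ⟨hlow _ hx, hup _ hx⟩
  refine ⟨H, hHd, fun w hw => ?_, fun w hw => (hbound w hw).1, fun w hw => (hbound w hw).2⟩
  have hw0 : 0 ≤ w.re := le_of_lt (show 0 < w.re from hw.2)
  simp only [H, if_pos hw0, hG' hw]


/-! ### Straightening the boundary -/

section solution

variable {Ω : Set ℂ} {u : ℂ → ℝ}

theorem harmonicOnNhd_of_isClassicalSolution (hΩ : IsOpen Ω) (hu : IsClassicalSolution Ω u) :
    InnerProductSpace.HarmonicOnNhd u Ω := fun z hz =>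
  ⟨hu.contDiffOn.contDiffAt (hΩ.mem_nhds hz), by
    filter_upwards [hΩ.mem_nhds hz] with w hw using hu.laplacian_eq_zero w hw⟩

/-- Superlevel sets at positive height stay away from the boundary. -/
theorem isCompact_superlevel (hΩ : IsOpen Ω) (hu : IsClassicalSolution Ω u) {c : ℝ} (hc : 0 < c)
    (z₁ : ℂ) (R : ℝ) : IsCompact {z | z ∈ closedBall z₁ R ∧ z ∈ Ω ∧ c ≤ u z} := by
  refine (isCompact_closedBall z₁ R).of_isClosed_subset (isClosed_of_closure_subset ?_)
    fun z hz => hz.1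
  intro z hz
  have hfreq := mem_closure_iff_frequently.1 hz
  have hlow : ¬ ∀ᶠ y in 𝓝[Ω] z, u y < c := by
    intro h
    rw [eventually_nhdsWithin_iff] at h
    obtain ⟨y, hy, hy'⟩ := (hfreq.and_eventually h).exists
    exact absurd (hy' hy.2.1) (not_lt.2 hy.2.2)
  have hzΩ : z ∈ Ω := by
    by_contra hn
    have hcl : z ∈ closure Ω := closure_mono (fun y hy => hy.2.1) hz
    exact hlow ((hu.tendsto_zero z (hΩ.frontier_eq ▸ ⟨hcl, hn⟩)).eventually (gt_mem_nhds hc))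
  refine ⟨isClosed_closedBall.closure_subset_iff.2 (fun y hy => hy.1) hz, hzΩ, ?_⟩
  by_contra! hlt
  exact hlow ((hu.contDiffOn.continuousOn z hzΩ).eventually (gt_mem_nhds hlt))

/-- Starting from a point `z₁` of `Ω` near the boundary, the inverse potential exists on a disc of
radius `δ` independent of `z₁`. It carries the right half-disc into `Ω`, with `u` becoming the real
part, and the axis into the boundary. -/
theorem exists_inverse_potential_disc (hΩ : IsOpen Ω) (hu : IsClassicalSolution Ω u)
    {x₀ z₁ : ℂ} {r δ : ℝ} (hlow : ∀ z ∈ Ω ∩ ball x₀ r, 1 / 2 ≤ ‖∇ u z‖)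
    (hup : ∀ z ∈ Ω ∩ ball x₀ r, ‖∇ u z‖ ≤ 2) (hz₁ : z₁ ∈ Ω) (hδ : u z₁ < δ)
    (hr : dist z₁ x₀ + 4 * δ < r) :
    ∃ H : ℂ → ℂ, DifferentiableOn ℂ H (ball 0 δ) ∧ (∀ w ∈ ball (0 : ℂ) δ, 1 / 2 ≤ ‖deriv H w‖) ∧
      (∀ w ∈ ball (0 : ℂ) δ, ‖deriv H w‖ ≤ 2) ∧ H (u z₁) = z₁ ∧
      (∀ w ∈ halfDisc δ, H w ∈ Ω ∧ u (H w) = w.re) ∧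
      ∀ w ∈ ball (0 : ℂ) δ, w.re = 0 → H w ∈ frontier Ω := by
  set U := Ω ∩ ball x₀ r with hUdef
  have hU : IsOpen U := hΩ.inter isOpen_ball
  set f : ℂ → ℂ := fun z => starRingEnd ℂ (∇ u z) with hf
  have hfd : DifferentiableOn ℂ f U := (differentiableOn_conj_gradient
    (harmonicOnNhd_of_isClassicalSolution hΩ hu)).mono inter_subset_left
  have hflow : ∀ z ∈ U, 1 / 2 ≤ ‖f z‖ := fun z hz => by
    simpa only [hf, RCLike.norm_conj] using hlow z hz
  have hfup : ∀ z ∈ U, ‖f z‖ ≤ 2 := fun z hz => by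
    simpa only [hf, RCLike.norm_conj] using hup z hz
  have hgrad : ∀ z ∈ U, HasGradientAt u (starRingEnd ℂ (f z)) z := fun z hz => by
    simp only [hf, conj_conj]
    exact ((hu.contDiffOn.contDiffAt (hΩ.mem_nhds hz.1)).differentiableAt
      two_ne_zero).hasGradientAt
  have hd : 0 < u z₁ := hu.pos z₁ hz₁
  have hδ0 : 0 < δ := hd.trans hδ
  set w₀ : ℂ := (u z₁ : ℂ) with hw₀
  have hw₀K : w₀ ∈ halfDisc δ := by
    refine ⟨?_, by simpa [hw₀] using hd⟩
    rw [mem_ball_zero_iff, hw₀, norm_real, Real.norm_of_nonneg hd.le]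
    exact hδ
  have hM : halfDisc δ ⊆ ball w₀ (2 * δ) := by
    intro w hw
    have h1 := hw.1
    have h2 := hw₀K.1
    rw [mem_ball] at *
    linarith [dist_triangle_right w w₀ 0]
  have hz₁U : z₁ ∈ U := ⟨hz₁, by rw [mem_ball]; linarith⟩
  -- On the copy of ratio `t ≤ τ`, the real part exceeds `(1 - τ) * u z₁`, so the values stay in a
  -- compact subset of `U`.
  obtain ⟨G, hG, hGz⟩ := IsInversePotential.exists_of_convex hU hfd hflow hfup isOpen_halfDisc
    convex_halfDisc hw₀K hz₁U hM (by
      intro τ hτ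
      have hc : 0 < (1 - τ) * u z₁ := mul_pos (by linarith [hτ.2]) hd
      obtain ⟨s, hs, hsub⟩ := (isCompact_superlevel hΩ hu hc z₁ (4 * δ)).exists_thickening_subset_open
        hU (by
          rintro z ⟨hz, hzΩ, -⟩
          refine ⟨hzΩ, ?_⟩
          rw [mem_ball]
          rw [mem_closedBall] at hz
          linarith [dist_triangle z z₁ x₀])
      refine ⟨s, hs, fun t ht G hG hGz w hw => ?_⟩
      refine Subset.trans (ball_subset_thickening (?_ : G w ∈ _) s) hsub
      have hcenter := center_mem_shrink (t := t) hw₀K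
      have hwK := shrink_subset convex_halfDisc hw₀K ht.1 (ht.2.trans hτ.2.le) hw
      refine ⟨?_, (hG w hw).1.1, ?_⟩
      · have h1 := hG.norm_sub_le hflow (convex_shrink convex_halfDisc) hw hcenter
        have h2 := hM hwK
        rw [mem_ball, dist_eq_norm] at h2
        rw [hGz] at h1
        rw [mem_closedBall, dist_eq_norm]
        linarith
      · rw [hG.apply_eq_re hflow hgrad (convex_shrink convex_halfDisc) hcenter
          (by rw [hGz, hw₀, ofReal_re]) hw]
        have h1 : 0 < (t⁻¹ • (w - w₀) + w₀).re := (mem_shrink.1 hw).2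
        simp only [add_re, smul_re, sub_re, hw₀, ofReal_re, smul_eq_mul] at h1
        have h2 : 0 < t * (t⁻¹ * (w.re - u z₁) + u z₁) := mul_pos ht.1 h1
        rw [mul_add, ← mul_assoc, mul_inv_cancel₀ ht.1.ne', one_mul] at h2
        have h3 : t * u z₁ ≤ τ * u z₁ := mul_le_mul_of_nonneg_right ht.2 hd.le
        linarith)
  have hGu : ∀ w ∈ halfDisc δ, u (G w) = w.re := fun w hw =>
    hG.apply_eq_re hflow hgrad convex_halfDisc hw₀K (by rw [hGz, hw₀, ofReal_re]) hw
  have hginv : ∀ w ∈ halfDisc δ, 1 / 2 ≤ ‖(f (G w))⁻¹‖ ∧ ‖(f (G w))⁻¹‖ ≤ 2 := by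
    intro w hw
    have h1 := hflow _ (hG w hw).1
    have h2 := hfup _ (hG w hw).1
    rw [norm_inv]
    constructor
    · rw [one_div]; exact inv_anti₀ (by linarith) h2
    · exact inv_le_of_inv_le₀ (by norm_num) (by linarith)
  -- The values of a continuous extension on the axis lie on the boundary, because `u` tends to
  -- zero there.
  have hfront : ∀ G' : ℂ → ℂ, EqOn G' G (halfDisc δ) → ∀ p ∈ ball (0 : ℂ) δ, p.re = 0 →
      ContinuousAt G' p → Tendsto G (𝓝[halfDisc δ] p) (𝓝[Ω] (G' p)) ∧ G' p ∈ frontier Ω := by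
    intro G' hG' p hp hp0 hcont
    have hne : (𝓝[halfDisc δ] p).NeBot := (tendsto_add_ofReal_halfDisc hp hp0.ge).neBot
    have hT : Tendsto G (𝓝[halfDisc δ] p) (𝓝 (G' p)) :=
      (hcont.tendsto.mono_left nhdsWithin_le_nhds).congr'
        (hG'.eventuallyEq_of_mem self_mem_nhdsWithin)
    have hmem : ∀ᶠ w in 𝓝[halfDisc δ] p, G w ∈ Ω := by
      filter_upwards [self_mem_nhdsWithin] with w hw using (hG w hw).1.1
    refine ⟨tendsto_nhdsWithin_iff.2 ⟨hT, hmem⟩, ?_⟩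
    rw [hΩ.frontier_eq]
    refine ⟨mem_closure_of_tendsto hT hmem, fun hin => ?_⟩
    have h1 := ((hu.contDiffOn.contDiffAt (hΩ.mem_nhds hin)).continuousAt.tendsto).comp hT
    have h2 : Tendsto (u ∘ G) (𝓝[halfDisc δ] p) (𝓝 p.re) :=
      ((continuous_re.tendsto p).mono_left nhdsWithin_le_nhds).congr' (by
        filter_upwards [self_mem_nhdsWithin] with w hw using (hGu w hw).symm)
    have := tendsto_nhds_unique h1 h2
    linarith [hu.pos _ hin]
  obtain ⟨G', hG'c, hG'⟩ := exists_continuous_extension convex_halfDisc (fun w hw => (hG w hw).2)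
    fun w hw => (hginv w hw).2
  obtain ⟨H, hHd, hHG, hHlow, hHup⟩ := exists_holomorphic_extension (fun w hw => (hG w hw).2)
    (fun w hw => (hginv w hw).1) (fun w hw => (hginv w hw).2) (by
      intro p hp hp0
      obtain ⟨hT, hfr⟩ := hfront G' hG' p hp hp0 hG'c.continuousAt
      have := ((hu.tendsto_norm_gradient _ hfr).comp hT).inv₀ one_ne_zero
      simpa [hf, Function.comp_def] using this)
  refine ⟨H, hHd, hHlow, hHup, (hHG hw₀K).trans hGz, fun w hw => ?_, fun w hw hw0 => ?_⟩
  · rw [hHG hw]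
    exact ⟨(hG w hw).1.1, hGu w hw⟩
  · exact (hfront H hHG w hw hw0
      (hHd.differentiableAt (isOpen_ball.mem_nhds hw)).continuousAt).2

end solution

section topology

/-- The image conditions of `IsDomainOfClass`, read pointwise. -/
theorem mem_iff_of_image_inter_eq {ψ : OpenPartialHomeomorph ℂ ℂ} {S T : Set ℂ}
    (h : ψ '' (ψ.source ∩ S) = ψ.target ∩ T) {z : ℂ} (hz : z ∈ ψ.source) : z ∈ S ↔ ψ z ∈ T := by
  constructor
  · intro hS
    exact (h.subset (mem_image_of_mem ψ ⟨hz, hS⟩)).2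
  · intro hT
    obtain ⟨z', hz', he⟩ := h.superset ⟨ψ.map_source hz, hT⟩
    rw [← ψ.injOn hz'.1 hz he]
    exact hz'.2

/-- Let `F` be a curve straightened to the real axis by `ψ` near `x₀`. An injective arc in `F` that
passes close to `x₀` and has its end points at a definite distance from `x₀` covers all of `F` near
`x₀`: in the chart it is a monotone parametrization of an interval. -/
theorem exists_forall_mem_arc {ψ : OpenPartialHomeomorph ℂ ℂ} {F : Set ℂ} {x₀ : ℂ}
    (hx₀ : x₀ ∈ ψ.source) (hx₀F : x₀ ∈ F) (hF : ∀ z ∈ ψ.source, z ∈ F ↔ (ψ z).im = 0)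
    {c : ℝ} (hc : 0 < c) :
    ∃ κ > 0, ∀ (a : ℝ) (γ : ℝ → ℂ), 0 < a → ContinuousOn γ (Icc (-a) a) →
      InjOn γ (Icc (-a) a) → MapsTo γ (Icc (-a) a) (ψ.source ∩ F) →
      c ≤ dist (γ a) x₀ → c ≤ dist (γ (-a)) x₀ → dist (γ 0) x₀ < κ →
      ∀ z ∈ F, dist z x₀ < κ → ∃ y ∈ Icc (-a) a, γ y = z := by
  have hx₀t : ψ x₀ ∈ ψ.target := ψ.map_source hx₀
  have h1 : ∀ᶠ w in 𝓝 (ψ x₀), dist (ψ.symm w) x₀ < c := by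
    have hcont := (ψ.continuousAt_symm hx₀t).tendsto
    rw [ψ.left_inv hx₀] at hcont
    exact hcont (ball_mem_nhds x₀ hc)
  obtain ⟨η, hη, hηball⟩ := Metric.eventually_nhds_iff.1 h1
  have h2 : ∀ᶠ z in 𝓝 x₀, z ∈ ψ.source ∧ dist (ψ z) (ψ x₀) < η :=
    (eventually_mem_set.2 (ψ.open_source.mem_nhds hx₀)).and
      ((ψ.continuousAt hx₀).tendsto (ball_mem_nhds _ hη))
  obtain ⟨κ, hκ, hκball⟩ := Metric.eventually_nhds_iff.1 h2
  have him₀ : (ψ x₀).im = 0 := (hF x₀ hx₀).1 hx₀F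
  have hdist : ∀ z ∈ ψ.source ∩ F, dist (ψ z) (ψ x₀) = |(ψ z).re - (ψ x₀).re| := by
    intro z hz
    have := (hF z hz.1).1 hz.2
    rw [Complex.dist_of_im_eq (by rw [this, him₀]), Real.dist_eq]
  refine ⟨κ, hκ, fun a γ ha hγc hγi hγm hca hca' hγ0 z hz hzx => ?_⟩
  set g : ℝ → ℝ := fun y => (ψ (γ y)).re with hg
  have hgc : ContinuousOn g (Icc (-a) a) := continuous_re.comp_continuousOn
    (ψ.continuousOn.comp hγc fun y hy => (hγm hy).1)
  have hgi : InjOn g (Icc (-a) a) := by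
    intro y hy y' hy' h
    refine hγi hy hy' (ψ.injOn (hγm hy).1 (hγm hy').1 (Complex.ext h ?_))
    rw [(hF _ (hγm hy).1).1 (hγm hy).2, (hF _ (hγm hy').1).1 (hγm hy').2]
  have hfar : ∀ y ∈ Icc (-a) a, c ≤ dist (γ y) x₀ → η ≤ |g y - (ψ x₀).re| := by
    intro y hy hcy
    by_contra! hlt
    rw [← hdist _ (hγm hy)] at hlt
    have := hηball hlt
    rw [ψ.left_inv (hγm hy).1] at this
    linarith
  have ha₁ : a ∈ Icc (-a) a := ⟨by linarith, le_rfl⟩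
  have ha₂ : -a ∈ Icc (-a) a := ⟨le_rfl, by linarith⟩
  have h0 : (0 : ℝ) ∈ Icc (-a) a := ⟨by linarith, ha.le⟩
  have hfa := hfar a ha₁ hca
  have hfa' := hfar (-a) ha₂ hca'
  have hg0 := (hκball hγ0).2
  rw [hdist _ (hγm h0), abs_lt] at hg0
  have hzs : z ∈ ψ.source ∩ F := ⟨(hκball hzx).1, hz⟩
  have hgz := (hκball hzx).2
  rw [hdist _ hzs, abs_lt] at hgz
  change -η < g 0 - _ ∧ g 0 - _ < η at hg0
  -- The end points of the arc leave the interval of radius `η` on both sides.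
  have hmem : (ψ z).re ∈ g '' Icc (-a) a := by
    rw [le_abs] at hfa hfa'
    rcases hgc.strictMonoOn_of_injOn_Icc' (by linarith) hgi with hmono | hanti
    · have l1 := hmono ha₂ h0 (by linarith)
      have l2 := hmono h0 ha₁ ha
      refine intermediate_value_Icc (by linarith) hgc ⟨?_, ?_⟩
      · rcases hfa' with h | h <;> linarith
      · rcases hfa with h | h <;> linarith
    · have l1 := hanti ha₂ h0 (by linarith)
      have l2 := hanti h0 ha₁ ha
      refine intermediate_value_Icc' (by linarith) hgc ⟨?_, ?_⟩
      · rcases hfa with h | h <;> linarith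
      · rcases hfa' with h | h <;> linarith
  obtain ⟨y, hy, hyz⟩ := hmem
  refine ⟨y, hy, ψ.injOn (hγm hy).1 hzs.1 (Complex.ext hyz ?_)⟩
  rw [(hF _ (hγm hy).1).1 (hγm hy).2, (hF _ hzs.1).1 hz]

/-- A chart sends points arbitrarily close to `x₀` below the real axis. -/
theorem exists_im_neg {ψ : OpenPartialHomeomorph ℂ ℂ} {x₀ : ℂ} (hx₀ : x₀ ∈ ψ.source)
    (him : (ψ x₀).im = 0) {N : Set ℂ} (hN : N ∈ 𝓝 x₀) :
    ∃ z ∈ N, z ∈ ψ.source ∧ (ψ z).im < 0 := by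
  have hx₀t : ψ x₀ ∈ ψ.target := ψ.map_source hx₀
  have hT : Tendsto (fun t : ℝ => ψ x₀ - t * I) (𝓝[>] 0) (𝓝 (ψ x₀)) := by
    have : Continuous fun t : ℝ => ψ x₀ - t * I := by fun_prop
    simpa using (this.tendsto 0).mono_left nhdsWithin_le_nhds
  have hcont := (ψ.continuousAt_symm hx₀t).tendsto
  rw [ψ.left_inv hx₀] at hcont
  have hpos : ∀ᶠ t : ℝ in 𝓝[>] 0, 0 < t := self_mem_nhdsWithin
  obtain ⟨t, ⟨ht, htN⟩, ht0⟩ := (((hT.eventually_mem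
    (ψ.open_target.mem_nhds hx₀t)).and ((hcont.comp hT).eventually_mem hN)).and hpos).exists
  refine ⟨ψ.symm (ψ x₀ - t * I), htN, ψ.map_target ht, ?_⟩
  rw [ψ.right_inv ht]
  simpa [him] using ht0

end topology

/-- Near a boundary point the boundary is straightened by a biholomorphic map `φ` whose real part
extends `u`. The map `φ` is the inverse of a reflected inverse potential; the topological chart
shows that the axis parametrizes the whole boundary near `x₀` and that `Ω` lies on one side. -/
theorem exists_straightening {Ω : Set ℂ} {u : ℂ → ℝ} (hΩ : IsDomainOfClass 0 Ω)
    (hu : IsClassicalSolution Ω u) {x₀ : ℂ} (hx₀ : x₀ ∈ frontier Ω) :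
    ∃ ρ > 0, ∃ φ : OpenPartialHomeomorph ℂ ℂ, φ.source = ball x₀ ρ ∧
      DifferentiableOn ℂ φ φ.source ∧ DifferentiableOn ℂ φ.symm φ.target ∧
      ∀ z ∈ ball x₀ ρ, (z ∈ Ω ↔ 0 < (φ z).re) ∧ (z ∈ frontier Ω ↔ (φ z).re = 0) ∧
        (z ∈ Ω → u z = (φ z).re) := by
  obtain ⟨hΩo, -, hloc⟩ := hΩ
  obtain ⟨ε, hε, ψ, hψs, -, -, -, hψΩ, hψF⟩ := hloc x₀ hx₀
  rw [← hψs] at hψΩ hψF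
  have hx₀s : x₀ ∈ ψ.source := hψs ▸ mem_ball_self hε
  have hΩiff : ∀ z ∈ ψ.source, z ∈ Ω ↔ 0 < (ψ z).im := fun z hz =>
    mem_iff_of_image_inter_eq hψΩ hz
  have hFiff : ∀ z ∈ ψ.source, z ∈ frontier Ω ↔ (ψ z).im = 0 := fun z hz =>
    mem_iff_of_image_inter_eq hψF hz
  have hev := (hu.tendsto_norm_gradient x₀ hx₀).eventually
    (Icc_mem_nhds (show (1 / 2 : ℝ) < 1 by norm_num) (show (1 : ℝ) < 2 by norm_num))
  rw [eventually_nhdsWithin_iff] at hev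
  obtain ⟨r₀, hr₀, hball⟩ := Metric.eventually_nhds_iff_ball.1 hev
  set r := min r₀ ε with hrdef
  have hr : 0 < r := lt_min hr₀ hε
  have hbd : ∀ z ∈ Ω ∩ ball x₀ r, ‖∇ u z‖ ∈ Icc (1 / 2 : ℝ) 2 := fun z hz =>
    hball z (ball_subset_ball (min_le_left _ _) hz.2) hz.1
  -- The radius `δ` and the length `a` of the arc are fixed before the point `z₁`, which is then
  -- chosen within a distance of `x₀` governed by `a` and by the chart.
  set δ := r / 16 with hδ
  set a := δ / 64 with ha
  have hδ0 : 0 < δ := by positivity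
  have ha0 : 0 < a := by positivity
  obtain ⟨κ₀, hκ₀, harc⟩ := exists_forall_mem_arc hx₀s hx₀ hFiff (show 0 < a / 8 by positivity)
  set κ := min κ₀ (a / 8) with hκdef
  have hκ : 0 < κ := lt_min hκ₀ (by positivity)
  have hκa : κ ≤ a / 8 := min_le_right _ _
  have : (𝓝[Ω] x₀).NeBot := mem_closure_iff_nhdsWithin_neBot.1 (frontier_subset_closure hx₀)
  obtain ⟨z₁, ⟨hz₁Ω, hz₁u⟩, hz₁x⟩ : ∃ z₁, (z₁ ∈ Ω ∧ u z₁ < κ / 4) ∧ z₁ ∈ ball x₀ (κ / 4) :=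
    (((eventually_mem_nhdsWithin).and ((hu.tendsto_zero x₀ hx₀).eventually
      (gt_mem_nhds (show 0 < κ / 4 by positivity)))).and
      (mem_nhdsWithin_of_mem_nhds (ball_mem_nhds x₀ (by positivity)))).exists
  rw [mem_ball] at hz₁x
  obtain ⟨H, hHd, hHlow, hHup, hHz, hHΩ, hHF⟩ := exists_inverse_potential_disc hΩo hu
    (fun z hz => (hbd z hz).1) (fun z hz => (hbd z hz).2) hz₁Ω (δ := δ) (by linarith) (by linarith)
  obtain ⟨e, hecoe, hesrc, hesymm, -, hanti⟩ :=
    exists_openPartialHomeomorph_of_norm_deriv_mem hδ0 hHd hHlow hHup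
  have hsub : ball (0 : ℂ) (δ / 32) ⊆ ball 0 δ := ball_subset_ball (by linarith)
  have hHdiff : ∀ w ∈ ball (0 : ℂ) δ, DifferentiableAt ℂ H w := fun w hw =>
    hHd.differentiableAt (isOpen_ball.mem_nhds hw)
  have hLip : ∀ w ∈ ball (0 : ℂ) δ, ‖H w - H 0‖ ≤ 2 * ‖w‖ := fun w hw => by
    simpa using (convex_ball (0 : ℂ) δ).norm_image_sub_le_of_norm_deriv_le hHdiff hHup
      (mem_ball_self hδ0) hw
  have hH0 : dist (H 0) x₀ < κ := by
    have h1 := hLip (u z₁) (by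
      rw [mem_ball_zero_iff, norm_real, Real.norm_of_nonneg (hu.pos _ hz₁Ω).le]; linarith)
    rw [hHz, norm_real, Real.norm_of_nonneg (hu.pos _ hz₁Ω).le, ← dist_eq_norm, dist_comm] at h1
    linarith [dist_triangle (H 0) z₁ x₀]
  have haxis : ∀ y ∈ Icc (-a) a, (y * I : ℂ) ∈ ball (0 : ℂ) (δ / 32) := fun y hy => by
    have : |y| ≤ a := abs_le.2 hy
    simp only [mem_ball_zero_iff, norm_mul, norm_real, norm_I, mul_one, Real.norm_eq_abs]
    linarith
  have hinj : InjOn H (ball 0 (δ / 32)) := by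
    rw [← hecoe, ← hesrc]; exact e.injOn
  have hend : ∀ y : ℝ, |y| = a → a / 8 ≤ dist (H (y * I)) x₀ := by
    intro y hy
    have h1 := hanti _ (haxis y (abs_le.1 hy.le)) 0 (mem_ball_self (by positivity))
    rw [sub_zero, norm_mul, norm_I, mul_one, norm_real, Real.norm_eq_abs, hy, ← dist_eq_norm] at h1
    linarith [dist_triangle_right (H (y * I)) (H 0) x₀, dist_comm (H 0) x₀]
  have hfr := harc a (fun y => H (y * I)) ha0
    (hHd.continuousOn.comp (by fun_prop) fun y hy => hsub (haxis y hy))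
    (fun y hy y' hy' h => by simpa using hinj (haxis y hy) (haxis y' hy') h)
    (fun y hy => ⟨by
      have h1 := hLip _ (hsub (haxis y hy))
      have h2 : |y| ≤ a := abs_le.2 hy
      rw [norm_mul, norm_I, mul_one, norm_real, Real.norm_eq_abs, ← dist_eq_norm] at h1
      rw [hψs, mem_ball]
      linarith [dist_triangle (H (y * I)) (H 0) x₀, min_le_right r₀ ε],
      hHF _ (hsub (haxis y hy)) (by simp)⟩)
    (hend a (abs_of_pos ha0)) (by simpa using hend (-a) (by rw [abs_neg, abs_of_pos ha0]))
    (by simpa using hH0.trans_le (min_le_left _ _))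
  obtain ⟨y₀, hy₀, hHy₀⟩ := hfr x₀ hx₀ (by simpa using hκ₀)
  -- A small disc around the preimage of `x₀`, on which the image stays in the ball of radius `κ₀`.
  set p : ℂ := y₀ * I with hp
  have hpmem := haxis y₀ hy₀
  have hnhds : ball (0 : ℂ) (δ / 32) ∩ H ⁻¹' ball x₀ κ₀ ∈ 𝓝 p := by
    refine inter_mem (isOpen_ball.mem_nhds hpmem) ?_
    exact (hHdiff p (hsub hpmem)).continuousAt (isOpen_ball.mem_nhds (by
      simp only [hHy₀]; exact mem_ball_self hκ₀))
  obtain ⟨σ, hσ, hσsub⟩ := Metric.mem_nhds_iff.1 hnhds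
  have himg : H '' ball p σ ∈ 𝓝 x₀ := by
    have hop := e.isOpen_image_of_subset_source isOpen_ball
      (show ball p σ ⊆ e.source from fun w hw => hesrc ▸ (hσsub hw).1)
    rw [hecoe] at hop
    exact hop.mem_nhds ⟨p, mem_ball_self hσ, hHy₀⟩
  have hpos : ∀ w ∈ ball p σ, 0 < w.re → H w ∈ Ω ∧ u (H w) = w.re := fun w hw h =>
    hHΩ w ⟨hsub (hσsub hw).1, h⟩
  have hzero : ∀ w ∈ ball p σ, H w ∈ frontier Ω ↔ w.re = 0 := by
    intro w hw
    refine ⟨fun h => ?_, hHF w (hsub (hσsub hw).1)⟩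
    obtain ⟨y, hy, hyw⟩ := hfr _ h (hσsub hw).2
    rw [← hinj (haxis y hy) (hσsub hw).1 hyw]
    simp
  have hneg : ∀ w ∈ ball p σ, w.re < 0 → H w ∉ Ω := by
    -- The left half of the disc is mapped to a connected set that avoids the boundary and
    -- contains exterior points.
    set S := ball p σ ∩ {w | w.re < 0} with hS
    have hSconn : IsPreconnected (H '' S) := by
      refine (((convex_ball p σ).inter (convex_halfSpace_re_lt 0)).isPreconnected).image _
        (hHd.continuousOn.mono fun w hw => hsub (hσsub hw.1).1)
    obtain ⟨z, ⟨w', hw', rfl⟩, hzs, hzim⟩ := exists_im_neg hx₀s ((hFiff x₀ hx₀s).1 hx₀) himg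
    have hzΩ : H w' ∉ Ω := fun h => by linarith [(hΩiff _ hzs).1 h]
    have hzF : H w' ∉ frontier Ω := fun h => by linarith [(hFiff _ hzs).1 h]
    have hw'S : w' ∈ S := by
      refine ⟨hw', ?_⟩
      rcases lt_trichotomy w'.re 0 with h | h | h
      · exact h
      · exact absurd ((hzero w' hw').2 h) hzF
      · exact absurd (hpos w' hw' h).1 hzΩ
    intro w hw hwre hwΩ
    refine hzΩ (hSconn.subset_of_closure_inter_subset hΩo ⟨H w, ⟨w, ⟨hw, hwre⟩, rfl⟩, hwΩ⟩ ?_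
      ⟨w', hw'S, rfl⟩)
    rintro _ ⟨hcl, x, hx, rfl⟩
    by_contra hxΩ
    have h1 : x.re < 0 := hx.2
    linarith [(hzero x hx.1).1 (hΩo.frontier_eq ▸ ⟨hcl, hxΩ⟩)]
  obtain ⟨ρ, hρ, hρsub⟩ := Metric.mem_nhds_iff.1 himg
  have hρtgt : ball x₀ ρ ⊆ e.target := fun z hz => by
    obtain ⟨w, hw, rfl⟩ := hρsub hz
    rw [← hecoe]
    exact e.map_source (hesrc ▸ (hσsub hw).1)
  refine ⟨ρ, hρ, e.symm.restrOpen (ball x₀ ρ) isOpen_ball, ?_, ?_, ?_, ?_⟩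
  · simpa using hρtgt
  · refine hesymm.mono ?_
    simp
  · refine (hHd.mono hsub).mono ?_ |>.congr ?_
    · intro w hw
      exact hesrc ▸ (show w ∈ e.source from hw.1)
    · intro w hw
      simp [hecoe]
  · intro z hz
    obtain ⟨w, hw, rfl⟩ := hρsub hz
    have hφ : (e.symm.restrOpen (ball x₀ ρ) isOpen_ball) (H w) = w := by
      have := e.left_inv (x := w) (hesrc ▸ (hσsub hw).1)
      rwa [hecoe] at this
    rw [hφ]
    refine ⟨⟨fun h => ?_, fun h => (hpos w hw h).1⟩, hzero w hw, fun h => ?_⟩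
    · by_contra! hle
      rcases hle.lt_or_eq with h' | h'
      · exact hneg w hw h' h
      · have := (hzero w hw).2 h'
        rw [hΩo.frontier_eq] at this
        exact this.2 h
    · rcases lt_trichotomy w.re 0 with h' | h' | h'
      · exact absurd h (hneg w hw h')
      · have := (hzero w hw).2 h'
        rw [hΩo.frontier_eq] at this
        exact absurd h this.2
      · exact (hpos w hw h').2


/-! ### Analytic charts and gluing of harmonic extensions -/

/-- Holomorphic straightenings of the boundary are admissible charts for every regularity class;
the quarter turn exchanges the right half-plane and the upper half-plane. -/
theorem isDomainOfClass_of_straightening {Ω : Set ℂ} (k : WithTop ℕ∞) (hΩ : IsOpen Ω)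
    (hne : (frontier Ω).Nonempty)
    (h : ∀ x₀ ∈ frontier Ω, ∃ ρ > 0, ∃ φ : OpenPartialHomeomorph ℂ ℂ, φ.source = ball x₀ ρ ∧
      DifferentiableOn ℂ φ φ.source ∧ DifferentiableOn ℂ φ.symm φ.target ∧
      ∀ z ∈ ball x₀ ρ, (z ∈ Ω ↔ 0 < (φ z).re) ∧ (z ∈ frontier Ω ↔ (φ z).re = 0)) :
    IsDomainOfClass k Ω := by
  refine ⟨hΩ, hne, fun x₀ hx₀ => ?_⟩
  obtain ⟨ρ, hρ, φ, hsrc, hφ, hφs, hφΩ⟩ := h x₀ hx₀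
  set ψ := φ.transHomeomorph (Homeomorph.mulLeft₀ I I_ne_zero) with hψ
  have hψsrc : ψ.source = ball x₀ ρ := hsrc
  have hψapp : ∀ z, ψ z = I * φ z := fun z => rfl
  have himage : ∀ {S T : Set ℂ}, (∀ z ∈ ball x₀ ρ, z ∈ S ↔ ψ z ∈ T) →
      ψ '' (ball x₀ ρ ∩ S) = ψ.target ∩ T := by
    intro S T hST
    rw [← hψsrc] at hST ⊢
    refine Subset.antisymm ?_ ?_
    · rintro _ ⟨z, ⟨hz, hzS⟩, rfl⟩
      exact ⟨ψ.map_source hz, (hST z hz).1 hzS⟩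
    · rintro w ⟨hw, hwT⟩
      have hz := ψ.map_target hw
      refine ⟨ψ.symm w, ⟨hz, (hST _ hz).2 ?_⟩, ψ.right_inv hw⟩
      rwa [ψ.right_inv hw]
  refine ⟨ρ, hρ, ψ, hψsrc, ?_, ?_, ?_, ?_, ?_⟩
  · rw [← ψ.image_source_eq_target, hψsrc]
    exact (isConnected_ball hρ).image _ (hψsrc ▸ ψ.continuousOn)
  · have hd : DifferentiableOn ℂ ψ ψ.source := hφ.const_mul I
    exact (hd.contDiffOn ψ.open_source).restrict_scalars ℝ
  · have hd : DifferentiableOn ℂ ψ.symm ψ.target :=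
      hφs.comp (differentiableOn_id.const_mul I⁻¹) fun w hw => hw
    exact (hd.contDiffOn ψ.open_target).restrict_scalars ℝ
  · refine himage fun z hz => ?_
    simpa [hψapp] using (hφΩ z hz).1
  · refine himage fun z hz => ?_
    simpa [hψapp] using (hφΩ z hz).2

/-- Local harmonic extensions across every boundary point glue to one on a neighbourhood of the
closure. -/
theorem exists_harmonic_extension {Ω : Set ℂ} {u : ℂ → ℝ} (hΩ : IsOpen Ω)
    (hu : InnerProductSpace.HarmonicOnNhd u Ω)
    (h : ∀ x ∈ frontier Ω, ∃ ρ > 0, ∃ v : ℂ → ℝ,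
      InnerProductSpace.HarmonicOnNhd v (ball x ρ) ∧ ∀ z ∈ ball x ρ, z ∈ Ω → u z = v z) :
    ∃ (V : Set ℂ) (v : ℂ → ℝ), IsOpen V ∧ closure Ω ⊆ V ∧
      InnerProductSpace.HarmonicOnNhd v V ∧ EqOn v u Ω := by
  classical
  choose! ρ hρ w hw hwu using h
  -- If two balls of a quarter of the radius meet, then the smaller one lies in the full larger
  -- ball, where the identity theorem applies: the smaller ball meets `Ω`.
  have hagree' : ∀ x ∈ frontier Ω, ∀ y ∈ frontier Ω, ρ y ≤ ρ x →
      ∀ z ∈ ball x (ρ x / 4), z ∈ ball y (ρ y / 4) → w x z = w y z := by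
    intro x hx y hy hle z hzx hzy
    have hρy := hρ y hy
    have hsub : ball y (ρ y / 4) ⊆ ball x (ρ x) := by
      intro z' hz'
      rw [mem_ball] at *
      linarith [dist_triangle z' y x, dist_triangle_left y x z]
    have hsub' : ball y (ρ y / 4) ⊆ ball y (ρ y) := ball_subset_ball (by linarith)
    obtain ⟨p, hpy, hpΩ⟩ := mem_closure_iff_nhds.1 (frontier_subset_closure hy) _
      (ball_mem_nhds y (show 0 < ρ y / 4 by positivity))
    have hax : AnalyticOnNhd ℝ (w x) (ball y (ρ y / 4)) := fun z' hz' =>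
      HarmonicAt.analyticAt (hw x hx z' (hsub hz'))
    have hay : AnalyticOnNhd ℝ (w y) (ball y (ρ y / 4)) := fun z' hz' =>
      HarmonicAt.analyticAt (hw y hy z' (hsub' hz'))
    refine hax.eqOn_of_preconnected_of_eventuallyEq hay (convex_ball _ _).isPreconnected hpy ?_ hzy
    filter_upwards [isOpen_ball.mem_nhds hpy, hΩ.mem_nhds hpΩ] with z' hz' hz'Ω
    rw [← hwu x hx z' (hsub hz') hz'Ω, ← hwu y hy z' (hsub' hz') hz'Ω]
  have hagree : ∀ x ∈ frontier Ω, ∀ y ∈ frontier Ω, ∀ z ∈ ball x (ρ x / 4),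
      z ∈ ball y (ρ y / 4) → w x z = w y z := by
    intro x hx y hy z hzx hzy
    rcases le_total (ρ y) (ρ x) with hle | hle
    · exact hagree' x hx y hy hle z hzx hzy
    · exact (hagree' y hy x hx hle z hzy hzx).symm
  let v : ℂ → ℝ := fun z => if z ∈ Ω then u z else
    if hz : ∃ x ∈ frontier Ω, z ∈ ball x (ρ x / 4) then w hz.choose z else 0
  have hvu : EqOn v u Ω := fun z hz => if_pos hz
  have hvw : ∀ x ∈ frontier Ω, EqOn v (w x) (ball x (ρ x / 4)) := by
    intro x hx z hz
    by_cases hzΩ : z ∈ Ω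
    · rw [hvu hzΩ, hwu x hx z (ball_subset_ball (by linarith [hρ x hx]) hz) hzΩ]
    · have hex : ∃ x ∈ frontier Ω, z ∈ ball x (ρ x / 4) := ⟨x, hx, hz⟩
      simp only [v, if_neg hzΩ, dif_pos hex]
      exact hagree _ hex.choose_spec.1 x hx z hex.choose_spec.2 hz
  refine ⟨Ω ∪ ⋃ x ∈ frontier Ω, ball x (ρ x / 4), v,
    hΩ.union (isOpen_biUnion fun _ _ => isOpen_ball), ?_, ?_, hvu⟩
  · rw [closure_eq_self_union_frontier]
    exact union_subset_union_right _ fun x hx =>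
      mem_biUnion hx (mem_ball_self (by linarith [hρ x hx]))
  · rintro z (hz | hz)
    · exact (InnerProductSpace.harmonicAt_congr_nhds
        (hvu.eventuallyEq_of_mem (hΩ.mem_nhds hz))).2 (hu z hz)
    · obtain ⟨x, hx, hzx⟩ := mem_iUnion₂.1 hz
      exact (InnerProductSpace.harmonicAt_congr_nhds
        ((hvw x hx).eventuallyEq_of_mem (isOpen_ball.mem_nhds hzx))).2
        (hw x hx z (ball_subset_ball (by linarith [hρ x hx]) hzx))

end FreeBoundary

theorem mainTheorem12 (Ω : Set ℂ) (hΩ : IsDomainOfClass 0 Ω)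
    (u : ℂ → ℝ) (hu : IsClassicalSolution Ω u) :
    (IsDomainOfClass ∞ Ω ∧ IsDomainOfClass ω Ω) ∧
      ∃ (V : Set ℂ) (v : ℂ → ℝ), IsOpen V ∧ closure Ω ⊆ V ∧
        InnerProductSpace.HarmonicOnNhd v V ∧ Set.EqOn v u Ω := by
  have hclass : ∀ k : WithTop ℕ∞, IsDomainOfClass k Ω := fun k =>
    FreeBoundary.isDomainOfClass_of_straightening k hΩ.1 hΩ.2.1 fun x₀ hx₀ => by
      obtain ⟨ρ, hρ, φ, hsrc, hφ, hφs, h⟩ := FreeBoundary.exists_straightening hΩ hu hx₀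
      exact ⟨ρ, hρ, φ, hsrc, hφ, hφs, fun z hz => ⟨(h z hz).1, (h z hz).2.1⟩⟩
  refine ⟨⟨hclass ∞, hclass ω⟩, FreeBoundary.exists_harmonic_extension hΩ.1
    (FreeBoundary.harmonicOnNhd_of_isClassicalSolution hΩ.1 hu) fun x hx => ?_⟩
  obtain ⟨ρ, hρ, φ, hsrc, hφ, -, h⟩ := FreeBoundary.exists_straightening hΩ hu hx
  refine ⟨ρ, hρ, fun z => (φ z).re, fun z hz => ?_, fun z hz => (h z hz).2.2⟩
  exact (hφ.analyticAt (φ.open_source.mem_nhds (hsrc ▸ hz))).harmonicAt_re
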